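/- All logarithms are in base $2$ and all Hilbert spaces are finite-dimensional. A state is a positive semidefinite operator of trace $1$; for operators $\rho,\sigma\ge 0$ of trace at most $1$ the fidelity is $F(\rho,\sigma)=\operatorname{tr}|\sqrt\rho\sqrt\sigma|+\sqrt{(1-\operatorname{tr}\rho)(1-\operatorname{tr}\sigma)}$. Subalgebras are unital $*$-subalgebras. For a subalgebra $N\subseteq B(H)$, let $E_N:B(H)\to N$ be the trace-preserving conditional expectation, i.e. the unique linear map onto $N$ with $\operatorname{tr}(xy)=\operatorname{tr}(xE_N(y))$ for all $x\in N$, $y\in B(H)$. Put $$D_{\max}(\rho\|\sigma)=\log\inf\{t>0:\rho\le t\sigma\},\qquad D_{\max,E_N}(\rho)=D_{\max}(\rho\|E_N(\rho)),$$ $$D^{\varepsilon}_{\max,E_N}(\rho)=\inf\{D_{\max,E_N}(\rho') : \rho'\in B(H)\text{ a state},\ F(\rho,\rho')\ge 1-\varepsilon\}.$$ For a subalgebra $M\subseteq B(K)$, $K\neq 0$, the Pimsner–Popa index is $\lambda_M=\max\{\lambda>0:\lambda x\le E_M(x)\ \text{for all } x\in B(K),\ x\ge 0\}$; a projection $e\ne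 0$ in $B(K)$ is index-achieving for $M$ if $E_M(e)=\lambda_M f$ for some projection $f\in M$. For every such $M$ fix an index-achieving projection $e_M$, and let $\rho_{e_M}=e_M/\operatorname{tr}(e_M)$ be the corresponding maximally coherent state. An $M$–$N$ dephasing-covariant incoherent operation (DIO) is a quantum channel (completely positive trace-preserving linear map) $\Phi:B(K)\to B(H)$ with $\Phi\circ E_M=E_N\circ\Phi$. The one-shot $\varepsilon$-coherence cost of $\rho$ under DIO is $$C^{\varepsilon}_{DIO}(\rho)=\inf_{M\subseteq B(K)}\Big\{\log\lambda_M^{-1} : \sup_{\Phi}F\big(\rho,\Phi(\rho_{e_M})\big)\ge 1-\varepsilon\Big\},$$ where the infimum is over all nonzero finite-dimensional Hilbert spaces $K$ and all subalgebras $M\subseteq B(K)$, and the supremum is over all $M$–$N$ DIO $\Phi$. **Theorem.** Let $H$ be a finite-dimensional Hilbert space, $N\subseteq B(H)$ a subalgebra, $\rho\in B(H)$ a state and $\varepsilon\ge 0$. Then, for every choice of the index-achieving projections $e_M$, $$D^{\varepsilon}_{\max,E_N}(\rho)\ \le\ C^{\varepsilon}_{DIO}(\rho)\ \le\ D^{\varepsilon}_{\max,E_N}(\rho)+1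 .$$ -/

import Mathlib

open scoped MatrixOrder ComplexOrder

namespace SubalgebraCoherence

variable {ι κ : Type*} [Fintype ι] [DecidableEq ι] [Fintype κ] [DecidableEq κ]

/-! Operators on the finite-dimensional Hilbert space `ℂ^ι` are matrices indexed by `ι`; the order
`A ≤ B` on them is the Loewner order (`B - A` is positive semidefinite). -/

/-! ### The trace-preserving conditional expectation -/

/-- For a *-subalgebra `N`, the map sending an operator `y` to the functional `x ↦ tr (x y)` on `N`. -/
noncomputable def traceDual (N : StarSubalgebra ℂ (Matrix ι ι ℂ)) :
    Matrix ι ι ℂ →ₗ[ℂ] Module.Dual ℂ N.toSubalgebra.toSubmodule :=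
  (((LinearMap.mul ℂ (Matrix ι ι ℂ)).compr₂ (Matrix.traceLinearMap ι ℂ ℂ)).flip).compl₂
    N.toSubalgebra.toSubmodule.subtype

theorem traceDual_apply (N : StarSubalgebra ℂ (Matrix ι ι ℂ)) (y : Matrix ι ι ℂ)
    (x : N.toSubalgebra.toSubmodule) :
    traceDual N y x = (x.1 * y).trace := rfl

theorem eq_zero_of_trace (N : StarSubalgebra ℂ (Matrix ι ι ℂ)) {z : Matrix ι ι ℂ}
    (hz : z ∈ N) (h : ∀ x ∈ N, (x * z).trace = 0) : z = 0 :=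
  Matrix.trace_conjTranspose_mul_self_eq_zero_iff.1 (h (star z) (star_mem hz))

/-- There is exactly one linear map `E` with values in `N` such that `tr (x y) = tr (x E(y))` for
all `x ∈ N` and all `y`. -/
theorem existsUnique_condExp (N : StarSubalgebra ℂ (Matrix ι ι ℂ)) :
    ∃! E : Matrix ι ι ℂ →ₗ[ℂ] Matrix ι ι ℂ,
      (∀ y, E y ∈ N) ∧ ∀ x ∈ N, ∀ y, (x * y).trace = (x * E y).trace := by
  set S := N.toSubalgebra.toSubmodule with hS
  have hinj : Function.Injective ((traceDual N).comp S.subtype) := by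
    rw [injective_iff_map_eq_zero]
    intro z hz
    apply Subtype.ext
    refine eq_zero_of_trace N z.2 fun x hx => ?_
    exact LinearMap.congr_fun hz ⟨x, hx⟩
  let e := LinearMap.linearEquivOfInjective _ hinj
    (Subspace.dual_finrank_eq (K := ℂ) (V := S)).symm
  have he : ∀ y, (traceDual N) (e.symm (traceDual N y)).1 = traceDual N y := fun y =>
    e.apply_symm_apply (traceDual N y)
  refine ⟨S.subtype.comp (e.symm.toLinearMap.comp (traceDual N)),
    ⟨fun y => (e.symm (traceDual N y)).2, fun x hx y => ?_⟩, ?_⟩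
  · exact (LinearMap.congr_fun (he y) ⟨x, hx⟩).symm
  · rintro E ⟨h1, h2⟩
    ext1 y
    apply sub_eq_zero.1
    refine eq_zero_of_trace N (sub_mem (h1 y) (e.symm (traceDual N y)).2) fun x hx => ?_
    have h3 : (x * (e.symm (traceDual N y)).1).trace = (x * y).trace :=
      LinearMap.congr_fun (he y) ⟨x, hx⟩
    rw [mul_sub, Matrix.trace_sub, ← h2 x hx y]
    exact sub_eq_zero.2 h3.symm

/-- The trace-preserving conditional expectation `E_N` onto the *-subalgebra `N`: the unique map
onto `N` with `tr (x y) = tr (x E_N(y))` for all `x ∈ N` and all `y`. -/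
noncomputable def condExp (N : StarSubalgebra ℂ (Matrix ι ι ℂ)) :
    Matrix ι ι ℂ →ₗ[ℂ] Matrix ι ι ℂ :=
  (existsUnique_condExp N).choose

theorem condExp_mem (N : StarSubalgebra ℂ (Matrix ι ι ℂ)) (y : Matrix ι ι ℂ) :
    condExp N y ∈ N :=
  (existsUnique_condExp N).choose_spec.1.1 y

theorem trace_mul_condExp (N : StarSubalgebra ℂ (Matrix ι ι ℂ)) {x : Matrix ι ι ℂ} (hx : x ∈ N)
    (y : Matrix ι ι ℂ) : (x * y).trace = (x * condExp N y).trace :=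
  (existsUnique_condExp N).choose_spec.1.2 x hx y

/-! ### States, fidelity, channels -/

/-- A quantum state (density operator). -/
def IsState (ρ : Matrix ι ι ℂ) : Prop := ρ.PosSemidef ∧ ρ.trace = 1

/-- The (generalized) fidelity `tr |√ρ √σ| + √((1 - tr ρ) (1 - tr σ))` of two substates. -/
noncomputable def fidelity (ρ σ : Matrix ι ι ℂ) : ℝ :=
  (CFC.abs (CFC.sqrt ρ * CFC.sqrt σ)).trace.re + √((1 - ρ.trace.re) * (1 - σ.trace.re))

/-- Complete positivity: for every `k`, the map `id_k ⊗ Φ`, that is, the entrywise application of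
`Φ` to `k × k` block matrices, preserves positive semidefiniteness. -/
def IsCompletelyPositive (Φ : Matrix κ κ ℂ →ₗ[ℂ] Matrix ι ι ℂ) : Prop :=
  ∀ (k : ℕ) (X : Matrix (Fin k) (Fin k) (Matrix κ κ ℂ)),
    (Matrix.comp _ _ _ _ ℂ X).PosSemidef → (Matrix.comp _ _ _ _ ℂ (X.map Φ)).PosSemidef

/-- A quantum channel: a completely positive trace-preserving linear map. -/
structure IsChannel (Φ : Matrix κ κ ℂ →ₗ[ℂ] Matrix ι ι ℂ) : Prop where
  completelyPositive : IsCompletelyPositive Φ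
  tracePreserving : ∀ x, (Φ x).trace = x.trace

/-- `Φ` is an `M`-`N` dephasing-covariant incoherent operation: a quantum channel with
`Φ ∘ E_M = E_N ∘ Φ`. -/
structure IsDIO (M : StarSubalgebra ℂ (Matrix κ κ ℂ)) (N : StarSubalgebra ℂ (Matrix ι ι ℂ))
    (Φ : Matrix κ κ ℂ →ₗ[ℂ] Matrix ι ι ℂ) : Prop where
  isChannel : IsChannel Φ
  covariant : Φ ∘ₗ condExp M = condExp N ∘ₗ Φ

/-! ### Max-relative entropy -/

/-- `D_max(ρ‖σ) = log₂ inf {t > 0 | ρ ≤ t σ}`, with value `⊤` if there is no such `t`. -/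
noncomputable def Dmax (ρ σ : Matrix ι ι ℂ) : EReal :=
  sInf ((fun t : ℝ => ((Real.logb 2 t : ℝ) : EReal)) '' {t : ℝ | 0 < t ∧ ρ ≤ t • σ})

/-- `D_{max,E_N}(ρ) = D_max(ρ‖E_N(ρ))`. -/
noncomputable def DmaxE (N : StarSubalgebra ℂ (Matrix ι ι ℂ)) (ρ : Matrix ι ι ℂ) : EReal :=
  Dmax ρ (condExp N ρ)

/-- `D^ε_{max,E_N}(ρ) = inf {D_{max,E_N}(ρ') | ρ' a state with F(ρ, ρ') ≥ 1 - ε}`. -/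
noncomputable def smoothDmaxE (N : StarSubalgebra ℂ (Matrix ι ι ℂ)) (ε : ℝ)
    (ρ : Matrix ι ι ℂ) : EReal :=
  sInf (DmaxE N '' {ρ' | IsState ρ' ∧ 1 - ε ≤ fidelity ρ ρ'})

/-! ### Index and coherence cost -/

/-- The Pimsner-Popa index `λ(B(H) : M)`, the largest `t > 0` with `t x ≤ E_M(x)` for all
positive semidefinite `x`. -/
noncomputable def popaIndex (M : StarSubalgebra ℂ (Matrix κ κ ℂ)) : ℝ :=
  sSup {t : ℝ | 0 < t ∧ ∀ x : Matrix κ κ ℂ, x.PosSemidef → t • x ≤ condExp M x}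

/-- `e` is an index-achieving projection for `M`: a nonzero orthogonal projection such that
`E_M(e) = λ(B(K) : M) f` for some orthogonal projection `f ∈ M`. -/
def IsIndexAchieving (M : StarSubalgebra ℂ (Matrix κ κ ℂ)) (e : Matrix κ κ ℂ) : Prop :=
  IsStarProjection e ∧ e ≠ 0 ∧
    ∃ f : Matrix κ κ ℂ, IsStarProjection f ∧ f ∈ M ∧ condExp M e = popaIndex M • f

/-- The flat state `e / tr e` of a nonzero projection `e`; it is the maximally coherent state when
`e` is index-achieving. -/
noncomputable def flatState (e : Matrix κ κ ℂ) : Matrix κ κ ℂ := e.trace⁻¹ • e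

/-- The optimal fidelity with which `M`-`N` dephasing-covariant incoherent operations turn the
maximally coherent state `e / tr e` of `M` into `ρ`. -/
noncomputable def dilutionFidelity (N : StarSubalgebra ℂ (Matrix ι ι ℂ))
    (M : StarSubalgebra ℂ (Matrix κ κ ℂ)) (e : Matrix κ κ ℂ) (ρ : Matrix ι ι ℂ) : ℝ :=
  sSup {x : ℝ | ∃ Φ : Matrix κ κ ℂ →ₗ[ℂ] Matrix ι ι ℂ,
    IsDIO M N Φ ∧ x = fidelity ρ (Φ (flatState e))}

/-- The one-shot `ε`-`N`-coherence cost of `ρ` under dephasing-covariant incoherent operations: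
the infimum of `log₂ λ(B(K) : M)⁻¹` over all finite-dimensional Hilbert spaces `K = ℂ^n` and
subalgebras `M ⊆ B(K)`, with reference projection `e n M`, such that the dilution fidelity is at
least `1 - ε`. Only the pairs for which `e n M` really is an index-achieving projection take part
(this leaves out the zero space `n = 0`). -/
noncomputable def costDIO
    (e : (n : ℕ) → StarSubalgebra ℂ (Matrix (Fin n) (Fin n) ℂ) → Matrix (Fin n) (Fin n) ℂ)
    (N : StarSubalgebra ℂ (Matrix ι ι ℂ)) (ε : ℝ) (ρ : Matrix ι ι ℂ) : EReal :=
  sInf {c : EReal | ∃ (n : ℕ) (M : StarSubalgebra ℂ (Matrix (Fin n) (Fin n) ℂ)),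
    IsIndexAchieving M (e n M) ∧ 1 - ε ≤ dilutionFidelity N M (e n M) ρ ∧
    c = ((Real.logb 2 (popaIndex M)⁻¹ : ℝ) : EReal)}

end SubalgebraCoherence

namespace SubalgebraCoherence

/-! Lower bound: a DIO `Φ` is positive, so applying it to `λ_M x ≤ E_M x` and using covariance gives
`λ_M Φ x ≤ E_N (Φ x)` (`IsDIO.le_inv_popaIndex_smul`). Every state produced from `M` thus has
`D_max,E_N` at most `log λ_M⁻¹`. The supremum over `Φ` need not be known to be attained: compactness
yields a state with the same inequality and at least the optimal fidelity.

Upper bound: let `σ ≤ t E_N σ`. Scalars `M = ℂ1` on `ℂ^d` suffice, with `d = ⌊t⌋ + 1`: the index is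
`1/d` and index-achieving projections have rank one. Measuring `{e, 1 - e}` and preparing `σ` or `τ
= (d E_N σ - σ)/(d - 1)` is a DIO that maps `e` to `σ` (`exists_isDIO_bot_eq`). Since `t ≥ 1`, `d ≤
2t`, which costs the extra `1`. -/

open scoped Matrix.Norms.L2Operator in
theorem isClosed_setOf_posSemidef {n : Type*} [Fintype n] [DecidableEq n] :
    IsClosed {a : Matrix n n ℂ | a.PosSemidef} := by
  simpa only [Matrix.nonneg_iff_posSemidef] using
    CStarAlgebra.isClosed_nonneg (A := Matrix n n ℂ)

/-! ### Positivity of the conditional expectation and a finite index bound -/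

section CondExp

variable {ι : Type*} [Fintype ι] [DecidableEq ι] (N : StarSubalgebra ℂ (Matrix ι ι ℂ))

theorem condExp_eq_of_trace {y z : Matrix ι ι ℂ} (hz : z ∈ N)
    (h : ∀ x ∈ N, (x * y).trace = (x * z).trace) : condExp N y = z := by
  refine sub_eq_zero.1 (eq_zero_of_trace N (sub_mem (condExp_mem N y) hz) fun x hx => ?_)
  rw [mul_sub, Matrix.trace_sub, ← trace_mul_condExp N hx, h x hx, sub_self]

theorem condExp_of_mem {y : Matrix ι ι ℂ} (hy : y ∈ N) : condExp N y = y :=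
  condExp_eq_of_trace N hy fun _ _ => rfl

theorem condExp_condExp (y : Matrix ι ι ℂ) : condExp N (condExp N y) = condExp N y :=
  condExp_of_mem N (condExp_mem N y)

theorem trace_condExp (y : Matrix ι ι ℂ) : (condExp N y).trace = y.trace := by
  simpa using (trace_mul_condExp N (one_mem N) y).symm

theorem condExp_conjTranspose (y : Matrix ι ι ℂ) :
    condExp N y.conjTranspose = (condExp N y).conjTranspose := by
  refine condExp_eq_of_trace N (star_mem (condExp_mem N y)) fun x hx => ?_
  have h := congrArg star (trace_mul_condExp N (star_mem hx) y)
  rw [← Matrix.trace_conjTranspose, ← Matrix.trace_conjTranspose, Matrix.conjTranspose_mul,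
    Matrix.conjTranspose_mul, Matrix.star_eq_conjTranspose, Matrix.conjTranspose_conjTranspose,
    Matrix.trace_mul_comm, Matrix.trace_mul_comm _ x] at h
  exact h

theorem trace_mul_nonneg {n : Type*} [Fintype n] [DecidableEq n] {a b : Matrix n n ℂ}
    (ha : a.PosSemidef) (hb : b.PosSemidef) : 0 ≤ (a * b).trace := by
  obtain ⟨c, rfl⟩ := CStarAlgebra.nonneg_iff_eq_star_mul_self.1 ha.nonneg
  rw [mul_assoc, Matrix.trace_mul_comm]
  exact (hb.mul_mul_conjTranspose_same c).trace_nonneg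

-- `N` is closed, being a finite-dimensional subspace, hence stable under functional calculus.
open scoped Matrix.Norms.L2Operator in
theorem negPart_mem {y : Matrix ι ι ℂ} (hy : y ∈ N) : y⁻ ∈ N := by
  have : IsClosed (N : Set (Matrix ι ι ℂ)) :=
    N.toSubalgebra.toSubmodule.closed_of_finiteDimensional
  exact cfcₙ_mem (𝕜' := ℂ) _ hy

/-- Testing against `z⁻ ∈ N` gives `0 ≤ tr (z⁻ y) = tr (z⁻ z) = -tr ((z⁻)²)`, which forces `z⁻ = 0`.
-/
theorem condExp_posSemidef {y : Matrix ι ι ℂ} (hy : y.PosSemidef) :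
    (condExp N y).PosSemidef := by
  set z := condExp N y with hz
  have hsa : IsSelfAdjoint z := by
    have := condExp_conjTranspose N y
    rw [hy.isHermitian.eq] at this
    exact this.symm
  have hneg : z⁻.PosSemidef := Matrix.nonneg_iff_posSemidef.1 (CFC.negPart_nonneg z)
  have h1 : 0 ≤ (z⁻ * z).trace := by
    rw [hz, ← trace_mul_condExp N (negPart_mem N (condExp_mem N y))]
    exact trace_mul_nonneg hneg hy
  have h2 : z⁻ * z = -(z⁻.conjTranspose * z⁻) := by
    rw [hneg.isHermitian.eq]
    nth_rw 2 [← CFC.posPart_sub_negPart z hsa]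
    rw [mul_sub, CFC.negPart_mul_posPart, zero_sub]
  rw [h2, Matrix.trace_neg] at h1
  have h3 := (Matrix.posSemidef_conjTranspose_mul_self z⁻).trace_nonneg
  have h4 : z⁻ = 0 := Matrix.trace_conjTranspose_mul_self_eq_zero_iff.1
    (le_antisymm (neg_nonneg.1 h1) h3)
  exact Matrix.nonneg_iff_posSemidef.1 ((CFC.negPart_eq_zero_iff z hsa).1 h4)

/-- Left multiplication by `a` is injective on the finite-dimensional `N`, hence reaches `1`. -/
theorem inv_mem {a : Matrix ι ι ℂ} (ha : a ∈ N) (hu : IsUnit a) : a⁻¹ ∈ N := by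
  let S := N.toSubalgebra.toSubmodule
  let f : S →ₗ[ℂ] S := (LinearMap.mulLeft ℂ a).restrict (p := S) (q := S)
    fun x hx => N.mul_mem ha hx
  have hf : Function.Injective f := fun x y h => Subtype.ext <|
    hu.mul_left_cancel (congrArg Subtype.val h)
  obtain ⟨b, hb⟩ := LinearMap.surjective_of_injective hf ⟨1, N.one_mem⟩
  have hb' : a * b.1 = 1 := congrArg Subtype.val hb
  rw [Matrix.inv_eq_right_inv hb']
  exact b.2

theorem le_trace_smul_one {n : Type*} [Fintype n] [DecidableEq n] {a : Matrix n n ℂ}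
    (ha : a.PosSemidef) : a ≤ a.trace • (1 : Matrix n n ℂ) := by
  have h := ha.isHermitian.spectral_theorem
  rw [Matrix.le_iff]
  set U := ha.isHermitian.eigenvectorUnitary
  have hU : (U : Matrix n n ℂ) * (U : Matrix n n ℂ).conjTranspose = 1 :=
    Unitary.mul_star_self_of_mem U.2
  have : a.trace • (1 : Matrix n n ℂ) - a = U.1 * (Matrix.diagonal fun i =>
      a.trace - (ha.isHermitian.eigenvalues i : ℂ)) * U.1.conjTranspose := by
    have h2 : (Matrix.diagonal fun i => a.trace - (ha.isHermitian.eigenvalues i : ℂ)) =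
      a.trace • (1 : Matrix n n ℂ) - Matrix.diagonal (RCLike.ofReal ∘ ha.isHermitian.eigenvalues) := by
      ext i j
      by_cases hij : i = j <;> simp [Matrix.diagonal, hij]
    rw [h2, mul_sub, sub_mul, mul_smul_comm, smul_mul_assoc, mul_one, hU]
    congr 1
  rw [this]
  refine Matrix.PosSemidef.mul_mul_conjTranspose_same (Matrix.PosSemidef.diagonal fun i => ?_) _
  rw [ha.isHermitian.trace_eq_sum_eigenvalues]
  simp only [Pi.zero_apply, sub_nonneg]
  exact Finset.single_le_sum (f := fun i => ((ha.isHermitian.eigenvalues i : ℝ) : ℂ))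
    (fun i _ => by exact_mod_cast ha.eigenvalues_nonneg i) (Finset.mem_univ i)

/-- With `a = c* c`, this is `le_trace_smul_one` for `c⁻* x c⁻¹`, conjugated back by `c`. -/
theorem le_trace_inv_mul_smul {n : Type*} [Fintype n] [DecidableEq n] {a x : Matrix n n ℂ}
    (ha : a.PosDef) (hx : x.PosSemidef) : x ≤ (x * a⁻¹).trace • a := by
  obtain ⟨c, hc⟩ := CStarAlgebra.nonneg_iff_eq_star_mul_self.1 ha.posSemidef.nonneg
  rw [Matrix.star_eq_conjTranspose] at hc
  have hcu : IsUnit c.det := by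
    have h := (Matrix.isUnit_iff_isUnit_det a).1 ha.isUnit
    rw [hc, Matrix.det_mul] at h
    exact isUnit_of_mul_isUnit_right h
  have h := le_trace_smul_one (hx.conjTranspose_mul_mul_same c⁻¹)
  rw [Matrix.le_iff] at h ⊢
  have h1 := h.conjTranspose_mul_mul_same c
  have htr : ((c⁻¹).conjTranspose * x * c⁻¹).trace = (x * a⁻¹).trace := by
    rw [mul_assoc, Matrix.trace_mul_comm, hc, Matrix.mul_inv_rev, Matrix.conjTranspose_nonsing_inv,
      mul_assoc]
  have hx' : c.conjTranspose * ((c⁻¹).conjTranspose * x * c⁻¹) * c = x := by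
    rw [Matrix.conjTranspose_nonsing_inv]
    have : IsUnit c.conjTranspose.det := by
      rw [Matrix.det_conjTranspose]; exact hcu.star
    simp only [← mul_assoc]
    rw [Matrix.mul_nonsing_inv _ this, one_mul, mul_assoc, Matrix.nonsing_inv_mul _ hcu, mul_one]
  rwa [mul_sub, sub_mul, hx', htr, mul_smul_comm, smul_mul_assoc, mul_one, ← hc] at h1

/-- This makes the index positive. For `a = E x + δ`, `a⁻¹ ∈ N` gives `tr (x a⁻¹) = tr (E x a⁻¹) =
card ι - δ tr a⁻¹ ≤ card ι`; then `δ → 0`. -/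
theorem le_card_smul_condExp {x : Matrix ι ι ℂ} (hx : x.PosSemidef) :
    x ≤ (Fintype.card ι : ℂ) • condExp N x := by
  have key : ∀ δ : ℝ, 0 < δ →
      ((Fintype.card ι : ℂ) • (condExp N x + (δ : ℂ) • 1) - x).PosSemidef := by
    intro δ hδ
    set a := condExp N x + (δ : ℂ) • (1 : Matrix ι ι ℂ) with ha
    have hδ' : (0 : ℂ) < δ := by exact_mod_cast hδ
    have hpd : a.PosDef := Matrix.PosDef.posSemidef_add (condExp_posSemidef N hx) (Matrix.PosDef.one.smul hδ')
    have hmem : a ∈ N := add_mem (condExp_mem N x) (N.smul_mem (one_mem N) _)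
    have hinv := inv_mem N hmem hpd.isUnit
    have h1 : (x * a⁻¹).trace ≤ Fintype.card ι := by
      rw [Matrix.trace_mul_comm, trace_mul_condExp N hinv, eq_sub_of_add_eq ha.symm, mul_sub,
        Matrix.nonsing_inv_mul _ ((Matrix.isUnit_iff_isUnit_det a).1 hpd.isUnit),
        Matrix.trace_sub, Matrix.trace_one, mul_smul_comm, mul_one, Matrix.trace_smul]
      exact sub_le_self _ (mul_nonneg hδ'.le hpd.inv.posSemidef.trace_nonneg)
    have h2 := Matrix.le_iff.1 (le_trace_inv_mul_smul hpd hx)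
    have h3 := (hpd.posSemidef.smul (sub_nonneg.2 h1)).add h2
    convert h3 using 1
    rw [sub_smul]; abel
  have hcont : Continuous fun δ : ℝ =>
      (Fintype.card ι : ℂ) • (condExp N x + (δ : ℂ) • (1 : Matrix ι ι ℂ)) - x := by fun_prop
  have h0 : (0 : ℝ) ∈ closure (Set.Ioi (0 : ℝ)) := by simp
  have := map_mem_closure (t := {a : Matrix ι ι ℂ | a.PosSemidef}) hcont h0 fun δ hδ => key δ hδ
  rw [isClosed_setOf_posSemidef.closure_eq] at this
  simpa [Matrix.le_iff] using this

end CondExp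

/-! ### The Pimsner–Popa index is positive and attained -/

section Index

variable {κ : Type*} [Fintype κ] [DecidableEq κ] (M : StarSubalgebra ℂ (Matrix κ κ ℂ))

theorem inv_card_mem_index_set [Nonempty κ] : (Fintype.card κ : ℝ)⁻¹ ∈
    {t : ℝ | 0 < t ∧ ∀ x : Matrix κ κ ℂ, x.PosSemidef → t • x ≤ condExp M x} := by
  have hc : (0 : ℝ) < Fintype.card κ := by exact_mod_cast Fintype.card_pos
  refine ⟨inv_pos.2 hc, fun x hx => ?_⟩
  have h := (Matrix.le_iff.1 (le_card_smul_condExp M hx)).smul (inv_nonneg.2 hc.le)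
  rw [Matrix.le_iff]
  convert h using 1
  rw [smul_sub]
  congr 1
  ext i j
  have hc' : (Fintype.card κ : ℂ) ≠ 0 := by exact_mod_cast hc.ne'
  simp [hc']

theorem bddAbove_index_set [Nonempty κ] : BddAbove
    {t : ℝ | 0 < t ∧ ∀ x : Matrix κ κ ℂ, x.PosSemidef → t • x ≤ condExp M x} := by
  refine ⟨1, fun t ht => ?_⟩
  have h := Matrix.le_iff.1 (ht.2 1 Matrix.PosSemidef.one)
  rw [condExp_of_mem M (one_mem M)] at h
  have h2 := h.diag_nonneg (i := Classical.arbitrary κ)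
  have h3 := (Complex.le_def.1 h2).1
  simpa using h3

theorem popaIndex_pos [Nonempty κ] : 0 < popaIndex M :=
  (inv_card_mem_index_set M).1.trans_le
    (le_csSup (bddAbove_index_set M) (inv_card_mem_index_set M))

theorem popaIndex_smul_le [Nonempty κ] {x : Matrix κ κ ℂ} (hx : x.PosSemidef) :
    popaIndex M • x ≤ condExp M x := by
  have hmem := csSup_mem_closure ⟨_, inv_card_mem_index_set M⟩ (bddAbove_index_set M)
  have hcont : Continuous fun t : ℝ => condExp M x - t • x := by fun_prop
  have h := map_mem_closure (t := {a : Matrix κ κ ℂ | a.PosSemidef}) hcont hmem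
    fun t ht => ht.2 x hx
  rwa [isClosed_setOf_posSemidef.closure_eq] at h

end Index

/-! ### Continuity of the fidelity and compactness of the state space -/

section Fidelity

variable {ι : Type*} [Fintype ι] [DecidableEq ι]

open scoped Matrix.Norms.L2Operator in
theorem continuousOn_fidelity (ρ : Matrix ι ι ℂ) :
    ContinuousOn (fidelity ρ) {σ | σ.PosSemidef} := by
  have h1 : ContinuousOn CFC.sqrt {σ : Matrix ι ι ℂ | σ.PosSemidef} := by
    simpa only [Matrix.nonneg_iff_posSemidef] using
      CFC.continuousOn_sqrt (A := Matrix ι ι ℂ)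
  have h2 : Continuous fun a : Matrix ι ι ℂ => (CFC.abs (CFC.sqrt ρ * a)).trace.re :=
    Complex.continuous_re.comp (Continuous.matrix_trace
      (CFC.continuous_abs.comp (continuous_const.mul continuous_id)))
  have h3 : Continuous fun a : Matrix ι ι ℂ =>
      √((1 - ρ.trace.re) * (1 - a.trace.re)) := by
    fun_prop
  exact (h2.comp_continuousOn h1).add h3.continuousOn

open scoped Matrix.Norms.L2Operator in
theorem isCompact_setOf_isState : IsCompact {σ : Matrix ι ι ℂ | IsState σ} := by
  have : ProperSpace (Matrix ι ι ℂ) := FiniteDimensional.proper ℂ _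
  refine Metric.isCompact_of_isClosed_isBounded ?_ ?_
  · exact isClosed_setOf_posSemidef.inter
      (isClosed_eq (Continuous.matrix_trace continuous_id) continuous_const)
  · refine isBounded_iff_forall_norm_le.2 ⟨1, fun σ hσ => ?_⟩
    refine (CStarAlgebra.norm_le_one_iff_of_nonneg σ hσ.1.nonneg).2 ?_
    simpa [hσ.2] using le_trace_smul_one hσ.1

theorem bddAbove_fidelity (ρ : Matrix ι ι ℂ) :
    BddAbove (fidelity ρ '' {σ | IsState σ}) :=
  isCompact_setOf_isState.bddAbove_image ((continuousOn_fidelity ρ).mono fun _ h => h.1)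

end Fidelity

/-! ### Channels and measure-and-prepare maps -/

section Channel

variable {ι κ : Type*}

theorem IsCompletelyPositive.posSemidef {Φ : Matrix κ κ ℂ →ₗ[ℂ] Matrix ι ι ℂ}
    (hΦ : IsCompletelyPositive Φ) {x : Matrix κ κ ℂ} (hx : x.PosSemidef) :
    (Φ x).PosSemidef :=
  (hΦ 1 (fun _ _ => x) (hx.submatrix Prod.snd)).submatrix fun i => (0, i)

theorem IsChannel.isState [Fintype ι] [Fintype κ] {Φ : Matrix κ κ ℂ →ₗ[ℂ] Matrix ι ι ℂ}
    (hΦ : IsChannel Φ) {x : Matrix κ κ ℂ} (hx : IsState x) : IsState (Φ x) :=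
  ⟨hΦ.completelyPositive.posSemidef hx.1, (hΦ.tracePreserving x).trans hx.2⟩

theorem conjTranspose_mul_self_of_isStarProjection [Fintype κ] {e : Matrix κ κ ℂ}
    (he : IsStarProjection e) : e.conjTranspose * e = e := by
  rw [← Matrix.star_eq_conjTranspose, he.isSelfAdjoint.star_eq, he.isIdempotentElem.eq]

theorem posSemidef_of_isStarProjection [Fintype κ] {e : Matrix κ κ ℂ}
    (he : IsStarProjection e) : e.PosSemidef :=
  conjTranspose_mul_self_of_isStarProjection he ▸ Matrix.posSemidef_conjTranspose_mul_self e

theorem isState_flatState [Fintype κ] {e : Matrix κ κ ℂ} (he : IsStarProjection e) (h0 : e ≠ 0) :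
    IsState (flatState e) := by
  have hsq := conjTranspose_mul_self_of_isStarProjection he
  have hpos := posSemidef_of_isStarProjection he
  have htr : e.trace ≠ 0 := fun h =>
    h0 (Matrix.trace_conjTranspose_mul_self_eq_zero_iff.1 (by rw [hsq, h]))
  refine ⟨hpos.smul ?_, by simp [flatState, htr]⟩
  exact inv_nonneg_of_nonneg hpos.trace_nonneg

/-- The functional `x ↦ tr (p x)` followed by the preparation of `σ`. -/
noncomputable def measurePrepare [Fintype κ] [DecidableEq κ] (p : Matrix κ κ ℂ) (σ : Matrix ι ι ℂ) :
    Matrix κ κ ℂ →ₗ[ℂ] Matrix ι ι ℂ :=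
  (Matrix.traceLinearMap κ ℂ ℂ ∘ₗ LinearMap.mulLeft ℂ p).smulRight σ

theorem measurePrepare_apply [Fintype κ] [DecidableEq κ] (p x : Matrix κ κ ℂ) (σ : Matrix ι ι ℂ) :
    measurePrepare p σ x = (p * x).trace • σ := rfl

/-- The amplified output is `(tr (p X i j)) ⊗ σ`. With `p = c* c`, the first factor is a partial
trace of `(1 ⊗ c) X (1 ⊗ c)*`, that is, a sum of principal submatrices. -/
theorem isCompletelyPositive_measurePrepare [Fintype ι] [Fintype κ] [DecidableEq κ]
    {p : Matrix κ κ ℂ} {σ : Matrix ι ι ℂ}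
    (hp : p.PosSemidef) (hσ : σ.PosSemidef) :
    IsCompletelyPositive (measurePrepare p σ) := by
  intro k X hX
  obtain ⟨c, hc⟩ := CStarAlgebra.nonneg_iff_eq_star_mul_self.1 hp.nonneg
  rw [Matrix.star_eq_conjTranspose] at hc
  have h1 := hX.mul_mul_conjTranspose_same (Matrix.kronecker (1 : Matrix (Fin k) (Fin k) ℂ) c)
  have h2 : (Matrix.of fun i j => (p * X i j).trace : Matrix (Fin k) (Fin k) ℂ).PosSemidef := by
    have h3 := Matrix.posSemidef_sum Finset.univ fun (l : κ) _ =>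
      h1.submatrix fun i : Fin k => (i, l)
    convert h3 using 1
    ext i j
    rw [Matrix.of_apply, hc, mul_assoc, Matrix.trace_mul_comm, Matrix.trace, Matrix.sum_apply]
    refine Finset.sum_congr rfl fun l _ => ?_
    simp [Matrix.mul_apply, Fintype.sum_prod_type, Matrix.one_apply, ite_mul,
      Finset.sum_ite_irrel, Finset.sum_mul, apply_ite]
  exact h2.kronecker hσ

theorem IsCompletelyPositive.add {Φ Ψ : Matrix κ κ ℂ →ₗ[ℂ] Matrix ι ι ℂ}
    (hΦ : IsCompletelyPositive Φ) (hΨ : IsCompletelyPositive Ψ) :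
    IsCompletelyPositive (Φ + Ψ) :=
  fun k X hX => (hΦ k X hX).add (hΨ k X hX)

end Channel

/-! ### States reachable from `M` -/

section LowerBound

variable {ι κ : Type*} [Fintype ι] [DecidableEq ι] [Fintype κ] [DecidableEq κ]
  (N : StarSubalgebra ℂ (Matrix ι ι ℂ)) (M : StarSubalgebra ℂ (Matrix κ κ ℂ))

/-- The completely depolarizing channel keeps the real `sSup` in `dilutionFidelity` from being the
default value `0` of an empty set. -/
theorem exists_isDIO [Nonempty ι] : ∃ Φ : Matrix κ κ ℂ →ₗ[ℂ] Matrix ι ι ℂ, IsDIO M N Φ := by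
  have hc : (Fintype.card ι : ℂ) ≠ 0 := by exact_mod_cast Fintype.card_ne_zero
  refine ⟨measurePrepare 1 ((Fintype.card ι : ℂ)⁻¹ • 1), ⟨?_, fun x => ?_⟩, ?_⟩
  · exact isCompletelyPositive_measurePrepare Matrix.PosSemidef.one
      (Matrix.PosSemidef.one.smul (inv_nonneg_of_nonneg (Nat.cast_nonneg _)))
  · simp [measurePrepare_apply, hc]
  · ext1 x
    simp [measurePrepare_apply, trace_condExp, condExp_of_mem N (one_mem N)]

theorem IsDIO.le_inv_popaIndex_smul {N : StarSubalgebra ℂ (Matrix ι ι ℂ)}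
    {M : StarSubalgebra ℂ (Matrix κ κ ℂ)} [Nonempty κ] {Φ : Matrix κ κ ℂ →ₗ[ℂ] Matrix ι ι ℂ}
    (hΦ : IsDIO M N Φ) {x : Matrix κ κ ℂ} (hx : x.PosSemidef) :
    Φ x ≤ (popaIndex M)⁻¹ • condExp N (Φ x) := by
  have h := hΦ.isChannel.completelyPositive.posSemidef (Matrix.le_iff.1 (popaIndex_smul_le M hx))
  have h2 := h.smul (inv_nonneg.2 (popaIndex_pos M).le)
  have h3 : Φ (condExp M x) = condExp N (Φ x) := LinearMap.congr_fun hΦ.covariant x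
  rw [Matrix.le_iff]
  rwa [map_sub, h3, LinearMap.map_smul_of_tower, smul_sub,
    inv_smul_smul₀ (popaIndex_pos M).ne'] at h2

theorem exists_isState_of_le_dilutionFidelity [Nonempty ι] [Nonempty κ] {e : Matrix κ κ ℂ}
    (he : IsStarProjection e) (h0 : e ≠ 0) {ρ : Matrix ι ι ℂ} {c : ℝ}
    (h : c ≤ dilutionFidelity N M e ρ) :
    ∃ σ, IsState σ ∧ c ≤ fidelity ρ σ ∧ σ ≤ (popaIndex M)⁻¹ • condExp N σ := by
  set K : Set (Matrix ι ι ℂ) := {σ | IsState σ} ∩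
    {σ | ((popaIndex M)⁻¹ • condExp N σ - σ).PosSemidef}
  have hE : Continuous (condExp N) := (condExp N).continuous_of_finiteDimensional
  have hcont : Continuous fun σ : Matrix ι ι ℂ => (popaIndex M)⁻¹ • condExp N σ - σ := by
    fun_prop
  have hK : IsCompact K := isCompact_setOf_isState.inter_right
    (isClosed_setOf_posSemidef.preimage hcont)
  -- The supremum lies in the closure of the achieved fidelities, hence in this closed image: it is
  -- attained in `K`, perhaps not by a channel output.
  have him : IsClosed (fidelity ρ '' K) :=
    (hK.image_of_continuousOn ((continuousOn_fidelity ρ).mono fun _ h => h.1.1)).isClosed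
  have hst := isState_flatState he h0
  have hsub : {x : ℝ | ∃ Φ : Matrix κ κ ℂ →ₗ[ℂ] Matrix ι ι ℂ,
      IsDIO M N Φ ∧ x = fidelity ρ (Φ (flatState e))} ⊆ fidelity ρ '' K := by
    rintro _ ⟨Φ, hΦ, rfl⟩
    exact ⟨_, ⟨hΦ.isChannel.isState hst, hΦ.le_inv_popaIndex_smul hst.1⟩, rfl⟩
  obtain ⟨Φ, hΦ⟩ := exists_isDIO N M
  obtain ⟨σ, hσ, hσ'⟩ := him.closure_subset (closure_mono hsub (csSup_mem_closure ⟨_, Φ, hΦ, rfl⟩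
    ((bddAbove_fidelity ρ).mono (hsub.trans (Set.image_mono Set.inter_subset_left)))))
  exact ⟨σ, hσ.1, h.trans hσ'.ge, hσ.2⟩

end LowerBound

/-! ### The algebra of scalars -/

section Trivial

variable {κ : Type*} [Fintype κ] [DecidableEq κ]

theorem condExp_bot [Nonempty κ] (x : Matrix κ κ ℂ) :
    condExp ⊥ x = ((Fintype.card κ : ℂ)⁻¹ * x.trace) • (1 : Matrix κ κ ℂ) := by
  have hc : (Fintype.card κ : ℂ) ≠ 0 := by exact_mod_cast Fintype.card_ne_zero
  refine condExp_eq_of_trace _ (SMulMemClass.smul_mem _ (one_mem _)) fun y hy => ?_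
  obtain ⟨c, rfl⟩ := StarSubalgebra.mem_bot.1 hy
  simp only [Algebra.algebraMap_eq_smul_one, smul_mul_assoc, one_mul, Matrix.trace_smul,
    Matrix.trace_one, smul_eq_mul]
  field_simp

theorem popaIndex_bot [Nonempty κ] :
    popaIndex (⊥ : StarSubalgebra ℂ (Matrix κ κ ℂ)) = (Fintype.card κ : ℝ)⁻¹ := by
  refine IsGreatest.csSup_eq ⟨inv_card_mem_index_set _, fun t ht => ?_⟩
  let i := Classical.arbitrary κ
  have hpos : (Matrix.single i i (1 : ℂ)).PosSemidef := by
    have := Matrix.posSemidef_conjTranspose_mul_self (Matrix.single i i (1 : ℂ))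
    simpa using this
  have h := Matrix.le_iff.1 (ht.2 _ hpos)
  rw [condExp_bot] at h
  have h2 := (Complex.le_def.1 (h.diag_nonneg (i := i))).1
  simpa using h2

theorem exists_isIndexAchieving_bot [Nonempty κ] :
    ∃ p : Matrix κ κ ℂ, IsIndexAchieving ⊥ p := by
  let i := Classical.arbitrary κ
  refine ⟨Matrix.single i i 1, ⟨?_, ?_⟩, fun h => ?_, 1, IsStarProjection.one _, one_mem _, ?_⟩
  · simp [IsIdempotentElem]
  · simp [IsSelfAdjoint, Matrix.star_eq_conjTranspose]
  · simpa using congrFun (congrFun h i) i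
  · rw [condExp_bot, popaIndex_bot]
    ext j k
    simp

/-- Here `E e = (tr e / d) 1 = f / d`, so `f = (tr e) 1`; idempotence and `tr e ≠ 0` leave only `tr
e = 1`. -/
theorem IsIndexAchieving.trace_eq_one_of_bot [Nonempty κ] {e : Matrix κ κ ℂ}
    (he : IsIndexAchieving ⊥ e) : e.trace = 1 := by
  obtain ⟨hp, h0, f, hf, -, h⟩ := he
  have hc : (Fintype.card κ : ℂ) ≠ 0 := by exact_mod_cast Fintype.card_ne_zero
  have htr : e.trace ≠ 0 := fun h => by
    simpa [flatState, h] using (isState_flatState hp h0).2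
  rw [condExp_bot, popaIndex_bot] at h
  let i := Classical.arbitrary κ
  have hf' : f = e.trace • (1 : Matrix κ κ ℂ) := by
    ext j k
    have := congrFun (congrFun h j) k
    simp only [Matrix.smul_apply, smul_eq_mul, Complex.real_smul, Complex.ofReal_inv,
      Complex.ofReal_natCast, mul_assoc] at this
    simpa using (mul_left_cancel₀ (inv_ne_zero hc) this).symm
  have h2 := hf.isIdempotentElem.eq
  rw [hf', smul_mul_smul_comm, one_mul] at h2
  have h3 := congrFun (congrFun h2 i) i
  simp only [Matrix.smul_apply, Matrix.one_apply_eq, smul_eq_mul, mul_one] at h3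
  exact mul_left_cancel₀ htr (h3.trans (mul_one _).symm)

end Trivial

/-! ### Dilution from the scalars, and the two bounds -/

section UpperBound

theorem IsState.nonempty {ι : Type*} [Fintype ι] {ρ : Matrix ι ι ℂ} (hρ : IsState ρ) : Nonempty ι := by
  by_contra h
  rw [not_nonempty_iff] at h
  simpa [Matrix.trace] using hρ.2

variable {ι κ : Type*} [Fintype ι] [DecidableEq ι] [Fintype κ] [DecidableEq κ]
  (N : StarSubalgebra ℂ (Matrix ι ι ℂ))

/-- `τ` is chosen so that `E_N τ = E_N σ` and `σ + (d - 1) τ = d E_N σ`. Both `E_N (Φ x)` and `Φ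
(E_M x)` then equal `(tr x) E_N σ`. -/
theorem exists_isDIO_bot_eq {e : Matrix κ κ ℂ} (he : IsStarProjection e) (hetr : e.trace = 1)
    (hκ : 1 < Fintype.card κ) {σ : Matrix ι ι ℂ} (hσ : IsState σ)
    (h : σ ≤ (Fintype.card κ : ℂ) • condExp N σ) :
    ∃ Φ : Matrix κ κ ℂ →ₗ[ℂ] Matrix ι ι ℂ, IsDIO ⊥ N Φ ∧ Φ (flatState e) = σ := by
  have : Nonempty κ := Fintype.card_pos_iff.1 (zero_lt_one.trans hκ)
  set d : ℂ := (Fintype.card κ : ℂ) with hd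
  have hd1 : 0 < d - 1 := sub_pos.2 (by rw [hd]; exact_mod_cast hκ)
  have hd0 : d ≠ 0 := by rw [hd]; exact_mod_cast Fintype.card_ne_zero
  set τ : Matrix ι ι ℂ := (d - 1)⁻¹ • (d • condExp N σ - σ) with hτ
  have hτpos : τ.PosSemidef := (Matrix.le_iff.1 h).smul (inv_nonneg_of_nonneg hd1.le)
  have hτE : condExp N τ = condExp N σ := by
    rw [hτ, map_smul, map_sub, map_smul, condExp_condExp]
    nth_rw 2 [← one_smul ℂ (condExp N σ)]
    rw [← sub_smul, inv_smul_smul₀ hd1.ne']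
  have hτtr : τ.trace = 1 := by rw [← trace_condExp N, hτE, trace_condExp, hσ.2]
  have hsum : σ + (d - 1) • τ = d • condExp N σ := by
    rw [hτ, smul_inv_smul₀ hd1.ne']; abel
  refine ⟨measurePrepare e σ + measurePrepare (1 - e) τ, ⟨⟨?_, fun x => ?_⟩, ?_⟩, ?_⟩
  · exact (isCompletelyPositive_measurePrepare (posSemidef_of_isStarProjection he) hσ.1).add
      (isCompletelyPositive_measurePrepare (posSemidef_of_isStarProjection he.one_sub) hτpos)
  · simp [measurePrepare_apply, hσ.2, hτtr, sub_mul]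
  · ext1 x
    simp only [LinearMap.comp_apply, LinearMap.add_apply, condExp_bot, map_smul, map_add,
      measurePrepare_apply, mul_one, hetr, one_smul, hτE, Matrix.trace_sub, Matrix.trace_one]
    rw [← hd, hsum, smul_smul, ← add_smul, ← Matrix.trace_add, ← add_mul,
      add_sub_cancel, one_mul]
    congr 1
    field_simp
  · simp [measurePrepare_apply, flatState, hetr, he.isIdempotentElem.eq, sub_mul]

theorem one_le_of_le_smul_condExp {σ : Matrix ι ι ℂ} (hσ : IsState σ) {t : ℝ}
    (h : σ ≤ t • condExp N σ) : 1 ≤ t := by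
  have h2 := (Complex.le_def.1 (Matrix.le_iff.1 h).trace_nonneg).1
  simpa [Matrix.trace_sub, Matrix.trace_smul, trace_condExp, hσ.2] using h2

theorem smoothDmaxE_le_costDIO
    (e : (n : ℕ) → StarSubalgebra ℂ (Matrix (Fin n) (Fin n) ℂ) → Matrix (Fin n) (Fin n) ℂ)
    {ρ : Matrix ι ι ℂ} (hρ : IsState ρ) (ε : ℝ) :
    smoothDmaxE N ε ρ ≤ costDIO e N ε ρ := by
  refine le_sInf ?_
  rintro _ ⟨n, M, ⟨he, h0, -⟩, h, rfl⟩
  have : Nonempty ι := hρ.nonempty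
  have : Nonempty (Fin n) := by
    by_contra hn
    rw [not_nonempty_iff] at hn
    exact h0 (Subsingleton.elim _ _)
  obtain ⟨σ, hσ, hf, hle⟩ := exists_isState_of_le_dilutionFidelity N M he h0 h
  have h1 : smoothDmaxE N ε ρ ≤ DmaxE N σ := sInf_le ⟨σ, ⟨hσ, hf⟩, rfl⟩
  exact h1.trans (sInf_le ⟨_, ⟨inv_pos.2 (popaIndex_pos M), hle⟩, rfl⟩)

theorem costDIO_le_logb_add_one
    {e : (n : ℕ) → StarSubalgebra ℂ (Matrix (Fin n) (Fin n) ℂ) → Matrix (Fin n) (Fin n) ℂ}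
    (he : ∀ (n : ℕ) (M : StarSubalgebra ℂ (Matrix (Fin n) (Fin n) ℂ)),
      (∃ p, IsIndexAchieving M p) → IsIndexAchieving M (e n M))
    {ρ σ : Matrix ι ι ℂ} {ε : ℝ} (hσ : IsState σ) (hf : 1 - ε ≤ fidelity ρ σ) {t : ℝ}
    (h : σ ≤ t • condExp N σ) :
    costDIO e N ε ρ ≤ ((Real.logb 2 t + 1 : ℝ) : EReal) := by
  have ht := one_le_of_le_smul_condExp N hσ h
  have ht0 : 0 ≤ t := zero_le_one.trans ht
  -- Unlike `⌈t⌉`, this is at least `2` even for `t = 1`, so division by `d - 1` is legitimate.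
  set d := ⌊t⌋₊ + 1
  have hd : 1 < d := Nat.lt_succ_of_le (Nat.le_floor (by simpa using ht))
  have htd : t ≤ d := by simpa [d] using (Nat.lt_floor_add_one t).le
  have hdt : (d : ℝ) ≤ t * 2 := by
    have := Nat.floor_le ht0
    push_cast [d]
    linarith
  have hach := he d ⊥ exists_isIndexAchieving_bot
  have hle : σ ≤ (Fintype.card (Fin d) : ℂ) • condExp N σ := by
    have h2 := (Matrix.le_iff.1 h).add
      ((condExp_posSemidef N hσ.1).smul (sub_nonneg.2 htd))
    rw [Matrix.le_iff]
    convert h2 using 1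
    rw [sub_smul, Fintype.card_fin]
    have : ((d : ℕ) : ℂ) • condExp N σ = ((d : ℕ) : ℝ) • condExp N σ := by
      rw [Nat.cast_smul_eq_nsmul, Nat.cast_smul_eq_nsmul]
    rw [this]
    abel
  obtain ⟨Φ, hΦ, hΦσ⟩ := exists_isDIO_bot_eq N hach.1 hach.trace_eq_one_of_bot
    (by simpa using hd) hσ hle
  have hst := isState_flatState hach.1 hach.2.1
  have hdil : 1 - ε ≤ dilutionFidelity N ⊥ (e d ⊥) ρ := by
    refine hf.trans (le_csSup ((bddAbove_fidelity ρ).mono ?_) ⟨Φ, hΦ, by rw [hΦσ]⟩)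
    rintro _ ⟨Ψ, hΨ, rfl⟩
    exact ⟨_, hΨ.isChannel.isState hst, rfl⟩
  have hcost : costDIO e N ε ρ ≤
      ((Real.logb 2 (popaIndex (⊥ : StarSubalgebra ℂ (Matrix (Fin d) (Fin d) ℂ)))⁻¹ : ℝ) : EReal) :=
    sInf_le ⟨d, ⊥, hach, hdil, rfl⟩
  refine hcost.trans (EReal.coe_le_coe_iff.2 ?_)
  rw [popaIndex_bot, inv_inv, Fintype.card_fin]
  have hlog : Real.logb 2 t + 1 = Real.logb 2 (t * 2) := by
    rw [Real.logb_mul (zero_lt_one.trans_le ht).ne' two_ne_zero,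
      Real.logb_self_eq_one one_lt_two]
  rw [hlog]
  exact Real.logb_le_logb_of_le one_lt_two (by positivity) hdt

theorem costDIO_le_smoothDmaxE_add_one
    {e : (n : ℕ) → StarSubalgebra ℂ (Matrix (Fin n) (Fin n) ℂ) → Matrix (Fin n) (Fin n) ℂ}
    (he : ∀ (n : ℕ) (M : StarSubalgebra ℂ (Matrix (Fin n) (Fin n) ℂ)),
      (∃ p, IsIndexAchieving M p) → IsIndexAchieving M (e n M))
    (ρ : Matrix ι ι ℂ) (ε : ℝ) :
    costDIO e N ε ρ ≤ smoothDmaxE N ε ρ + 1 := by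
  have h1 : (1 : EReal) ≠ ⊥ := EReal.coe_ne_bot 1
  have h2 : (1 : EReal) ≠ ⊤ := EReal.coe_ne_top 1
  -- Moving the finite `1` to the left leaves a bare infimum on the right, so `le_sInf` applies.
  rw [← EReal.sub_le_iff_le_add (.inl h1) (.inl h2)]
  refine le_sInf ?_
  rintro _ ⟨σ, ⟨hσ, hf⟩, rfl⟩
  refine le_sInf ?_
  rintro _ ⟨t, ⟨-, ht⟩, rfl⟩
  rw [EReal.sub_le_iff_le_add (.inl h1) (.inl h2)]
  exact_mod_cast costDIO_le_logb_add_one N he hσ hf ht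

end UpperBound

end SubalgebraCoherence

theorem mainTheorem5 {ι : Type*} [Fintype ι] [DecidableEq ι]
    (N : StarSubalgebra ℂ (Matrix ι ι ℂ))
    (ρ : Matrix ι ι ℂ) (hρ : SubalgebraCoherence.IsState ρ) (ε : ℝ) (hε : 0 ≤ ε)
    (e : (n : ℕ) → StarSubalgebra ℂ (Matrix (Fin n) (Fin n) ℂ) → Matrix (Fin n) (Fin n) ℂ)
    (he : ∀ (n : ℕ) (M : StarSubalgebra ℂ (Matrix (Fin n) (Fin n) ℂ)),
      (∃ p, SubalgebraCoherence.IsIndexAchieving M p) →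
        SubalgebraCoherence.IsIndexAchieving M (e n M)) :
    SubalgebraCoherence.smoothDmaxE N ε ρ ≤ SubalgebraCoherence.costDIO e N ε ρ ∧
      SubalgebraCoherence.costDIO e N ε ρ ≤ SubalgebraCoherence.smoothDmaxE N ε ρ + 1 :=
  ⟨SubalgebraCoherence.smoothDmaxE_le_costDIO N e hρ ε,
    SubalgebraCoherence.costDIO_le_smoothDmaxE_add_one N he ρ ε⟩
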